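/- For real $t,r$ let $\mathcal B_t(x)^r=\sum_{n\ge 0}\binom{tn+r}{n}\frac{r}{tn+r}x^n$ be Lambert's generalized binomial series ($\mathcal B_t$ itself is the case $r=1$), where $\binom an=a(a-1)\cdots(a-n+1)/n!$. (1) Let $h\ge 1$, let $\zeta\in\mathbb C$ be a primitive $h$-th root of unity, let $u\in\mathbb C\setminus\{0\}$ satisfy $|u|^{h+1}\le \frac{h^h}{(h+1)^{h+1}}$, fix any $h$-th root $u^{1/h}$ of $u$, and write $u^{-1/h}=(u^{1/h})^{-1}$, $u^{(h+1)/h}=(u^{1/h})^{h+1}$. Then the series $\mathcal B_{h+1}(x)$ converges absolutely at $x=u^{h+1}$; for $0\le j\le h-1$ the series $\mathcal B_{(h+1)/h}(x)$ and $\mathcal B_{(h+1)/h}(x)^{-1/h}$ converge absolutely at $x=\zeta^j u^{(h+1)/h}$, and there the second is the principal value of the $(-1/h)$-th power of the first. The $h+1$ roots of $1-\frac zu+z^{h+1}$, counted with multiplicity, are $$u\,\mathcal B_{h+1}(u^{h+1})\qquad\text{and}\qquad \zeta^{-j}u^{-1/h}\,\mathcal B_{(h+1)/h}\big(\zeta^j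 u^{(h+1)/h}\big)^{-1/h}\quad(0\le j\le h-1).$$ (2) The value $u=\frac12$ satisfies the condition of (1) for every $h\ge1$. (3) Let $h\ge 2$ and $u=\frac12$, let $\zeta$ and $u^{1/h}$ be as in (1), let $r_h=\frac12\mathcal B_{h+1}(2^{-(h+1)})$, and for $0\le j\le h-1$ let $r_j=\zeta^{-j}u^{-1/h}\mathcal B_{(h+1)/h}(\zeta^j u^{(h+1)/h})^{-1/h}$. Then $r_0,\dots,r_h$ are nonzero and pairwise distinct, one has the identity of power series $$\frac1{1-2z+z^{h+1}}=\sum_{i=0}^h\frac1{z-r_i}\prod_{\substack{0\le j\le h\\ j\ne i}}(r_i-r_j)^{-1},$$ and for every $n\ge0$ $$[z^n]\frac1{1-2z+z^{h+1}}=-\sum_{i=0}^h r_i^{-n-1}\prod_{\substack{0\le j\le h\\ j\neq i}}(r_i-r_j)^{-1}.$$ Consequently the generalized Fibonacci numbers of order $h$, given by $u_0=0$, $u_1=1$ and $u_n=\sum_{k=1}^{\min(h,n)}u_{n-k}$ for $n\ge2$ (so $\sum_n u_nz^n=\frac{z}{1-z-\cdots-z^h}=\frac{z(1-z)}{1-2z+z^{h+1}}$),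 satisfy for every $n\ge0$ the Binet-type formula $$u_n=\sum_{i=0}^h (r_i-1)\,r_i^{-n}\prod_{\substack{0\le j\le h\\ j\neq i}}(r_i-r_j)^{-1}.$$ -/

import Mathlib

open Finset

/-- The coefficient of `x ^ n` in Lambert's generalized binomial series `(B_t(x)) ^ r`, namely
`binom (t n + r) n * r / (t n + r)`, where `binom a n = a (a - 1) ⋯ (a - n + 1) / n!`. It is used
below only for `(t, r)` with `t n + r ≠ 0` for all `n`. -/
noncomputable def genBinomCoeff (t r : ℝ) (n : ℕ) : ℝ :=
  Ring.choose (t * n + r) n * (r / (t * n + r))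

/-- Lambert's generalized binomial series: the value at `x` of the series
`(B_t(x)) ^ r = ∑ n, binom (t n + r) n * r / (t n + r) * x ^ n`.
The function `B_t` itself is the case `r = 1`. -/
noncomputable def genBinom (t r : ℝ) (x : ℂ) : ℂ :=
  ∑' n : ℕ, (genBinomCoeff t r n : ℂ) * x ^ n

/-- The candidate roots of `1 - z / u + z ^ (h + 1)`, where `w` is the chosen value of `u ^ (1 / h)`:
for `j < h` it is `ζ ^ (-j) u ^ (-1 / h) B_{(h+1)/h}(ζ ^ j u ^ ((h+1)/h)) ^ (-1 / h)`,
and for `j = h` it is `u B_{h+1}(u ^ (h+1))`. -/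
noncomputable def lambertRoot (h : ℕ) (ζ u w : ℂ) (j : ℕ) : ℂ :=
  if j < h then
    (ζ ^ j)⁻¹ * w⁻¹ * genBinom (((h : ℝ) + 1) / h) (-1 / (h : ℝ)) (ζ ^ j * w ^ (h + 1))
  else
    u * genBinom ((h : ℝ) + 1) 1 (u ^ (h + 1))

/-- The generalized Fibonacci numbers of order `h`: `0, 1`, and then each term is the sum of the
`h` preceding ones (of all the preceding ones, as long as there are fewer than `h`). -/
def genFib (h : ℕ) : ℕ → ℕ
  | 0 => 0
  | 1 => 1
  | n + 2 => ∑ k : Fin (min h (n + 2)), genFib h (n + 1 - k)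
termination_by n => n

/-- The polynomial `r / n! * ∏ k ∈ [1, n - 1], (t n + r - k)` in `r`, which agrees with
`genBinomCoeff t r n` wherever `t n + r ≠ 0`. -/
noncomputable def rothe (t r : ℝ) : ℕ → ℝ
  | 0 => 1
  | n + 1 => r / (n + 1).factorial * ∏ k ∈ range n, (t * (n + 1) + r - (k + 1))

theorem rothe_zero_right (t r : ℝ) : rothe t r 0 = 1 := rfl

theorem rothe_zero_left_succ (t : ℝ) (n : ℕ) : rothe t 0 (n + 1) = 0 := by simp [rothe]

theorem rothe_add_one (t r : ℝ) (n : ℕ) :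
    rothe t (r + 1) (n + 1) = rothe t r (n + 1) + rothe t (r + t) n := by
  cases n with
  | zero => simp [rothe]
  | succ m =>
    simp only [rothe]
    rw [Finset.prod_range_succ',
      Finset.prod_range_succ (fun k : ℕ => t * (((m + 1 : ℕ) : ℝ) + 1) + r - (k + 1))]
    have e1 : ∏ k ∈ range m, (t * (((m + 1 : ℕ) : ℝ) + 1) + (r + 1) - (((k + 1 : ℕ) : ℝ) + 1)) =
        ∏ k ∈ range m, (t * ((m : ℝ) + 1) + (r + t) - (k + 1)) := by
      refine Finset.prod_congr rfl fun k _ => ?_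
      push_cast; ring
    have e2 : ∏ k ∈ range m, (t * (((m + 1 : ℕ) : ℝ) + 1) + r - ((k : ℝ) + 1)) =
        ∏ k ∈ range m, (t * ((m : ℝ) + 1) + (r + t) - (k + 1)) := by
      refine Finset.prod_congr rfl fun k _ => ?_
      push_cast; ring
    rw [e1, e2]
    have hf : ((m + 1 + 1).factorial : ℝ) = (m + 2) * (m + 1).factorial := by
      rw [Nat.factorial_succ]; push_cast; ring
    have h0 : ((m + 1).factorial : ℝ) ≠ 0 := by positivity
    have h1 : (m + 2 : ℝ) ≠ 0 := by positivity
    rw [hf]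
    push_cast
    field_simp
    ring

theorem exists_polynomial_eval_eq_rothe (t : ℝ) (n : ℕ) :
    ∃ p : Polynomial ℝ, ∀ r, p.eval r = rothe t r n := by
  cases n with
  | zero => exact ⟨1, fun r => by simp [rothe]⟩
  | succ n =>
    refine ⟨Polynomial.C ((n + 1).factorial : ℝ)⁻¹ * Polynomial.X *
      ∏ k ∈ range n, (Polynomial.C (t * (n + 1) - (k + 1)) + Polynomial.X), fun r => ?_⟩
    simp only [rothe, Polynomial.eval_mul, Polynomial.eval_prod, Polynomial.eval_add,
      Polynomial.eval_C, Polynomial.eval_X]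
    rw [div_eq_inv_mul]
    congr 1
    exact Finset.prod_congr rfl fun k _ => by ring

theorem polynomial_eq_zero_of_periodic {p : Polynomial ℝ} (h0 : p.eval 0 = 0)
    (h : ∀ r, p.eval (r + 1) = p.eval r) : p = 0 := by
  refine Polynomial.eq_of_infinite_eval_eq p 0
    (Set.Infinite.mono ?_ (Set.infinite_range_of_injective (Nat.cast_injective (R := ℝ))))
  rintro _ ⟨n, rfl⟩
  change p.eval (n : ℝ) = (0 : Polynomial ℝ).eval (n : ℝ)
  rw [Polynomial.eval_zero]
  induction n with
  | zero => simpa using h0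
  | succ n ih => rw [Nat.cast_succ, h, ih]

/-- The Rothe–Hagen convolution identity. -/
theorem sum_antidiagonal_rothe_mul (t : ℝ) (n : ℕ) : ∀ r s : ℝ,
    ∑ ij ∈ antidiagonal n, rothe t r ij.1 * rothe t s ij.2 = rothe t (r + s) n := by
  induction n with
  | zero => intro r s; simp [rothe]
  | succ n ih =>
    intro r s
    choose P hP using exists_polynomial_eval_eq_rothe t
    set q : Polynomial ℝ := ∑ ij ∈ antidiagonal (n + 1), P ij.1 * Polynomial.C (rothe t s ij.2) -
      (P (n + 1)).comp (Polynomial.X + Polynomial.C s)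
    have hq : ∀ r, q.eval r = ∑ ij ∈ antidiagonal (n + 1), rothe t r ij.1 * rothe t s ij.2 -
        rothe t (r + s) (n + 1) := by
      intro r
      simp [q, Polynomial.eval_finsetSum, hP]
    have : q = 0 := by
      refine polynomial_eq_zero_of_periodic ?_ fun r => ?_
      · rw [hq, Finset.Nat.sum_antidiagonal_succ]
        simp [rothe_zero_left_succ, rothe_zero_right]
      · rw [hq, hq, Finset.Nat.sum_antidiagonal_succ, Finset.Nat.sum_antidiagonal_succ]
        simp only [rothe_add_one, rothe_zero_right, add_mul, Finset.sum_add_distrib]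
        rw [ih, show r + 1 + s = r + s + 1 by ring, rothe_add_one,
          show r + t + s = r + s + t by ring]
        ring
    have h := hq r
    rw [this, Polynomial.eval_zero] at h
    linarith

theorem ring_choose_eq_prod (a : ℝ) (n : ℕ) :
    Ring.choose a n = (n.factorial : ℝ)⁻¹ * ∏ k ∈ range n, (a - k) := by
  rw [Ring.choose_eq_smul, smul_eq_mul, ← Polynomial.aeval_eq_smeval,
    Polynomial.aeval_def, ← Polynomial.eval_map, descPochhammer_map,
    descPochhammer_eval_eq_prod_range]

theorem genBinomCoeff_eq_rothe {t r : ℝ} {n : ℕ} (h : t * n + r ≠ 0) :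
    genBinomCoeff t r n = rothe t r n := by
  unfold genBinomCoeff
  cases n with
  | zero =>
    have : r ≠ 0 := by simpa using h
    simp [rothe, this]
  | succ n =>
    rw [ring_choose_eq_prod, Finset.prod_range_succ', rothe]
    push_cast at h ⊢
    have h0 : ((n + 1).factorial : ℝ) ≠ 0 := by positivity
    field_simp
    ring_nf

/-- The power series `B_t ^ r`. -/
noncomputable def lambertSeries (t r : ℝ) : PowerSeries ℝ := PowerSeries.mk (rothe t r)

theorem coeff_lambertSeries (t r : ℝ) (n : ℕ) :
    PowerSeries.coeff n (lambertSeries t r) = rothe t r n := PowerSeries.coeff_mk _ _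

theorem constantCoeff_lambertSeries (t r : ℝ) :
    PowerSeries.constantCoeff (lambertSeries t r) = 1 := by
  rw [← PowerSeries.coeff_zero_eq_constantCoeff_apply, coeff_lambertSeries, rothe_zero_right]

theorem lambertSeries_add (t r s : ℝ) :
    lambertSeries t (r + s) = lambertSeries t r * lambertSeries t s := by
  ext n
  simp only [PowerSeries.coeff_mul, coeff_lambertSeries, sum_antidiagonal_rothe_mul]

theorem lambertSeries_zero (t : ℝ) : lambertSeries t 0 = 1 := by
  ext n
  rw [coeff_lambertSeries, PowerSeries.coeff_one]
  cases n with
  | zero => simp [rothe]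
  | succ n => simp [rothe]

theorem lambertSeries_nat_mul (t r : ℝ) (n : ℕ) :
    lambertSeries t (n * r) = lambertSeries t r ^ n := by
  induction n with
  | zero => simp [lambertSeries_zero]
  | succ n ih => rw [Nat.cast_succ, add_mul, one_mul, lambertSeries_add, ih, pow_succ]

theorem lambertSeries_add_one (t r : ℝ) :
    lambertSeries t (r + 1) = lambertSeries t r + PowerSeries.X * lambertSeries t (r + t) := by
  ext n
  cases n with
  | zero => simp [constantCoeff_lambertSeries]
  | succ n =>
    rw [map_add, PowerSeries.coeff_succ_X_mul]
    simp only [coeff_lambertSeries, rothe_add_one]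

theorem lambertSeries_mul_neg (t r : ℝ) : lambertSeries t r * lambertSeries t (-r) = 1 := by
  rw [← lambertSeries_add, add_neg_cancel, lambertSeries_zero]

/-- The sum of the first `N` terms of a power series at a point. -/
noncomputable def partialEval (f : PowerSeries ℝ) (x : ℝ) (N : ℕ) : ℝ :=
  ∑ n ∈ range N, PowerSeries.coeff n f * x ^ n

theorem coeff_mul_nonneg {f g : PowerSeries ℝ} (hf : ∀ n, 0 ≤ PowerSeries.coeff n f)
    (hg : ∀ n, 0 ≤ PowerSeries.coeff n g) (n : ℕ) : 0 ≤ PowerSeries.coeff n (f * g) := by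
  rw [PowerSeries.coeff_mul]
  exact Finset.sum_nonneg fun p _ => mul_nonneg (hf _) (hg _)

theorem coeff_one_nonneg (n : ℕ) : 0 ≤ PowerSeries.coeff n (1 : PowerSeries ℝ) := by
  rw [PowerSeries.coeff_one]; split_ifs <;> norm_num

theorem coeff_pow_nonneg {f : PowerSeries ℝ} (hf : ∀ n, 0 ≤ PowerSeries.coeff n f) (k : ℕ) :
    ∀ n, 0 ≤ PowerSeries.coeff n (f ^ k) := by
  induction k with
  | zero => simpa using coeff_one_nonneg
  | succ k ih => rw [pow_succ]; exact coeff_mul_nonneg ih hf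

theorem partialEval_nonneg {f : PowerSeries ℝ} (hf : ∀ n, 0 ≤ PowerSeries.coeff n f) {x : ℝ}
    (hx : 0 ≤ x) (N : ℕ) : 0 ≤ partialEval f x N :=
  Finset.sum_nonneg fun n _ => mul_nonneg (hf n) (pow_nonneg hx n)

theorem partialEval_one_le (x : ℝ) (N : ℕ) : partialEval 1 x N ≤ 1 := by
  cases N with
  | zero => simp [partialEval]
  | succ N => simp [partialEval, PowerSeries.coeff_one]

theorem partialEval_one_succ (x : ℝ) (N : ℕ) : partialEval 1 x (N + 1) = 1 := by
  simp [partialEval, PowerSeries.coeff_one]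

theorem partialEval_X_mul (f : PowerSeries ℝ) (x : ℝ) (N : ℕ) :
    partialEval (PowerSeries.X * f) x (N + 1) = x * partialEval f x N := by
  simp only [partialEval, Finset.sum_range_succ', PowerSeries.coeff_succ_X_mul, Finset.mul_sum]
  simp only [PowerSeries.coeff_zero_eq_constantCoeff, map_mul, PowerSeries.constantCoeff_X]
  rw [zero_mul, zero_mul, add_zero]
  exact Finset.sum_congr rfl fun n _ => by ring

theorem partialEval_add (f g : PowerSeries ℝ) (x : ℝ) (N : ℕ) :
    partialEval (f + g) x N = partialEval f x N + partialEval g x N := by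
  simp only [partialEval, map_add, add_mul, Finset.sum_add_distrib]

theorem partialEval_mul_eq (f g : PowerSeries ℝ) (x : ℝ) (N : ℕ) :
    partialEval (f * g) x N = ∑ p ∈ (range N).biUnion antidiagonal,
      (PowerSeries.coeff p.1 f * x ^ p.1) * (PowerSeries.coeff p.2 g * x ^ p.2) := by
  rw [Finset.sum_biUnion]
  · refine Finset.sum_congr rfl fun n _ => ?_
    rw [PowerSeries.coeff_mul, Finset.sum_mul]
    refine Finset.sum_congr rfl fun p hp => ?_
    rw [← mem_antidiagonal.1 hp, pow_add]
    ring
  · intro m _ n _ hmn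
    rw [Function.onFun, Finset.disjoint_left]
    intro p hp hp'
    exact hmn ((mem_antidiagonal.1 hp).symm.trans (mem_antidiagonal.1 hp'))

theorem partialEval_mul_le {f g : PowerSeries ℝ} (hf : ∀ n, 0 ≤ PowerSeries.coeff n f)
    (hg : ∀ n, 0 ≤ PowerSeries.coeff n g) {x : ℝ} (hx : 0 ≤ x) (N : ℕ) :
    partialEval (f * g) x N ≤ partialEval f x N * partialEval g x N := by
  rw [partialEval_mul_eq, partialEval, partialEval, Finset.sum_mul_sum, ← Finset.sum_product']
  refine Finset.sum_le_sum_of_subset_of_nonneg (fun p hp => ?_) fun p _ _ => ?_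
  · simp only [mem_biUnion, mem_range, HasAntidiagonal.mem_antidiagonal, mem_product] at hp ⊢
    obtain ⟨n, hn, rfl⟩ := hp
    omega
  · exact mul_nonneg (mul_nonneg (hf _) (pow_nonneg hx _)) (mul_nonneg (hg _) (pow_nonneg hx _))

theorem le_partialEval_mul {f g : PowerSeries ℝ} (hf : ∀ n, 0 ≤ PowerSeries.coeff n f)
    (hg : ∀ n, 0 ≤ PowerSeries.coeff n g) {x : ℝ} (hx : 0 ≤ x) (M N : ℕ) :
    partialEval f x M * partialEval g x N ≤ partialEval (f * g) x (M + N) := by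
  rw [partialEval_mul_eq, partialEval, partialEval, Finset.sum_mul_sum, ← Finset.sum_product']
  refine Finset.sum_le_sum_of_subset_of_nonneg (fun p hp => ?_) fun p _ _ => ?_
  · simp only [mem_biUnion, mem_range, HasAntidiagonal.mem_antidiagonal, mem_product] at hp ⊢
    exact ⟨p.1 + p.2, by omega, rfl⟩
  · exact mul_nonneg (mul_nonneg (hf _) (pow_nonneg hx _)) (mul_nonneg (hg _) (pow_nonneg hx _))

theorem partialEval_pow_le {f : PowerSeries ℝ} (hf : ∀ n, 0 ≤ PowerSeries.coeff n f) {x : ℝ}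
    (hx : 0 ≤ x) (k N : ℕ) : partialEval (f ^ k) x N ≤ partialEval f x N ^ k := by
  induction k with
  | zero => simpa using partialEval_one_le x N
  | succ k ih =>
    rw [pow_succ, pow_succ]
    exact (partialEval_mul_le (coeff_pow_nonneg hf k) hf hx N).trans
      (mul_le_mul_of_nonneg_right ih (partialEval_nonneg hf hx N))

theorem le_partialEval_pow {f : PowerSeries ℝ} (hf : ∀ n, 0 ≤ PowerSeries.coeff n f) {x : ℝ}
    (hx : 0 ≤ x) (k N : ℕ) : partialEval f x N ^ k ≤ partialEval (f ^ k) x (k * N + 1) := by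
  induction k with
  | zero => simp [partialEval]
  | succ k ih =>
    rw [pow_succ, pow_succ]
    refine (mul_le_mul_of_nonneg_right ih (partialEval_nonneg hf hx N)).trans
      ((le_partialEval_mul (coeff_pow_nonneg hf k) hf hx _ _).trans_eq ?_)
    congr 1
    ring

theorem summable_of_partialEval_le {f : PowerSeries ℝ} (hf : ∀ n, 0 ≤ PowerSeries.coeff n f)
    {x : ℝ} (hx : 0 ≤ x) {c : ℝ} (h : ∀ N, partialEval f x N ≤ c) :
    Summable fun n => PowerSeries.coeff n f * x ^ n :=
  summable_of_sum_range_le (fun n => mul_nonneg (hf n) (pow_nonneg hx n)) h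

theorem coeff_subst_X_mul (f g : PowerSeries ℝ) {n N : ℕ} (hn : n < N) :
    PowerSeries.coeff n (f.subst (PowerSeries.X * g)) =
      ∑ k ∈ range N, PowerSeries.coeff k f * PowerSeries.coeff n ((PowerSeries.X * g) ^ k) := by
  have hs : PowerSeries.HasSubst (PowerSeries.X * g) :=
    PowerSeries.HasSubst.of_constantCoeff_zero' (by simp)
  rw [PowerSeries.coeff_subst' hs]
  simp only [smul_eq_mul]
  refine finsum_eq_sum_of_support_subset _ fun k hk => ?_
  by_contra hkN
  refine hk ?_
  have : n < k := by
    simp only [coe_range, Set.mem_Iio] at hkN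
    omega
  change _ * _ = (0 : ℝ)
  rw [mul_pow, PowerSeries.coeff_X_pow_mul', if_neg (by omega), mul_zero]

theorem rothe_nonneg {t r : ℝ} (ht : 1 ≤ t) (hr : 0 ≤ r) (n : ℕ) : 0 ≤ rothe t r n := by
  cases n with
  | zero => simp [rothe]
  | succ n =>
    refine mul_nonneg (by positivity) (Finset.prod_nonneg fun k hk => ?_)
    have hk : (k : ℝ) + 1 ≤ n := by exact_mod_cast mem_range.1 hk
    nlinarith [(Nat.cast_nonneg n : (0 : ℝ) ≤ n)]

theorem rothe_succ_nonpos {t r : ℝ} (ht : 1 ≤ t) (hr : r ≤ 0) (h : 1 ≤ t + r) (n : ℕ) :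
    rothe t r (n + 1) ≤ 0 := by
  refine mul_nonpos_of_nonpos_of_nonneg (div_nonpos_of_nonpos_of_nonneg hr (by positivity))
    (Finset.prod_nonneg fun k hk => ?_)
  have hk : (k : ℝ) + 1 ≤ n := by exact_mod_cast mem_range.1 hk
  nlinarith [(Nat.cast_nonneg n : (0 : ℝ) ≤ n)]

theorem coeff_lambertSeries_nonneg {t r : ℝ} (ht : 1 ≤ t) (hr : 0 ≤ r) (n : ℕ) :
    0 ≤ PowerSeries.coeff n (lambertSeries t r) := by
  rw [coeff_lambertSeries]; exact rothe_nonneg ht hr n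

theorem eq_of_pow_eq_of_constantCoeff {f g : PowerSeries ℝ} {n : ℕ} (hn : n ≠ 0)
    (hf : PowerSeries.constantCoeff f = 1) (hg : PowerSeries.constantCoeff g = 1)
    (h : f ^ n = g ^ n) : f = g := by
  have h1 := (Commute.all f g).geom_sum₂_mul n
  rw [h, sub_self] at h1
  rcases mul_eq_zero.1 h1 with h2 | h2
  · have h3 := congrArg PowerSeries.constantCoeff h2
    simp [hf, hg, hn] at h3
  · exact sub_eq_zero.1 h2

theorem lambertSeries_one_eq (t : ℝ) :
    lambertSeries t 1 = 1 + PowerSeries.X * lambertSeries t t := by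
  simpa [lambertSeries_zero] using lambertSeries_add_one t 0

theorem lambertSeries_inv_pow {h : ℕ} (hh : 1 ≤ h) (t : ℝ) :
    lambertSeries t (1 / h) ^ h = lambertSeries t 1 := by
  rw [← lambertSeries_nat_mul, mul_one_div_cancel (by positivity)]

/-- With `t = (h + 1) / h`, `E = B_t ^ (1 / h)` and `F = x E = 1 - 1 / B_t`, one has
`E = (1 - F) ^ (- 1 / h)`. -/
theorem lambertSeries_eq_subst {h : ℕ} (hh : 1 ≤ h) :
    (lambertSeries 1 (1 / h)).subst
      (PowerSeries.X * lambertSeries (((h : ℝ) + 1) / h) (1 / h)) =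
        lambertSeries (((h : ℝ) + 1) / h) (1 / h) := by
  set t : ℝ := ((h : ℝ) + 1) / h with ht
  have h0 : (h : ℝ) ≠ 0 := by positivity
  set F := PowerSeries.X * lambertSeries t (1 / h) with hF
  have hs : PowerSeries.HasSubst F := PowerSeries.HasSubst.of_constantCoeff_zero' (by simp [hF])
  have e1 : lambertSeries t 1 * (1 - F) = 1 := by
    have : lambertSeries t t = lambertSeries t 1 * lambertSeries t (1 / h) := by
      rw [← lambertSeries_add]; congr 1; rw [ht]; field_simp
    have h2 := lambertSeries_one_eq t
    rw [this] at h2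
    rw [hF]
    linear_combination h2
  have e2 : (lambertSeries 1 1).subst F * (1 - F) = 1 := by
    have h2 := congrArg (PowerSeries.substAlgHom (R := ℝ) hs) (lambertSeries_one_eq 1)
    rw [map_add, map_mul, map_one, PowerSeries.substAlgHom_X, PowerSeries.coe_substAlgHom] at h2
    linear_combination h2
  have hne : (1 - F) ≠ 0 := by
    intro h; rw [h, mul_zero] at e1; exact zero_ne_one e1
  refine eq_of_pow_eq_of_constantCoeff (n := h) (by omega) ?_ (constantCoeff_lambertSeries _ _) ?_
  · rw [← PowerSeries.coeff_zero_eq_constantCoeff_apply, coeff_subst_X_mul _ _ zero_lt_one]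
    simp [constantCoeff_lambertSeries]
  · rw [← PowerSeries.subst_pow hs, lambertSeries_inv_pow hh, lambertSeries_inv_pow hh]
    exact mul_right_cancel₀ hne (e2.trans e1.symm)

theorem coeff_lambertSeries_one_one (n : ℕ) : PowerSeries.coeff n (lambertSeries 1 1) = 1 := by
  induction n with
  | zero => simp [constantCoeff_lambertSeries]
  | succ n ih =>
    rw [lambertSeries_one_eq, map_add, PowerSeries.coeff_succ_X_mul, ih, PowerSeries.coeff_one]
    simp

theorem partialEval_lambertSeries_one_pow_le {h : ℕ} (hh : 1 ≤ h) {y : ℝ} (hy : 0 ≤ y)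
    (hy1 : y < 1) (N : ℕ) : partialEval (lambertSeries 1 (1 / h)) y N ^ h ≤ (1 - y)⁻¹ := by
  refine (le_partialEval_pow (coeff_lambertSeries_nonneg le_rfl (by positivity)) hy h N).trans ?_
  rw [lambertSeries_inv_pow hh]
  simp only [partialEval, coeff_lambertSeries_one_one, one_mul]
  rw [← tsum_geometric_of_lt_one hy hy1]
  exact (summable_geometric_of_lt_one hy hy1).sum_le_tsum _ fun _ _ => pow_nonneg hy _

theorem partialEval_lambertSeries_le_subst {h : ℕ} (hh : 1 ≤ h) {x : ℝ} (hx : 0 ≤ x) (N : ℕ) :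
    partialEval (lambertSeries (((h : ℝ) + 1) / h) (1 / h)) x N ≤
      partialEval (lambertSeries 1 (1 / h)) (partialEval
        (PowerSeries.X * lambertSeries (((h : ℝ) + 1) / h) (1 / h)) x N) N := by
  have ht : 1 ≤ ((h : ℝ) + 1) / h := by
    rw [le_div_iff₀ (by positivity)]; linarith
  set E := lambertSeries (((h : ℝ) + 1) / h) (1 / h) with hE
  have hF : ∀ n, 0 ≤ PowerSeries.coeff n (PowerSeries.X * E) :=
    coeff_mul_nonneg (fun n => by rw [PowerSeries.coeff_X]; split_ifs <;> norm_num)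
      (coeff_lambertSeries_nonneg ht (by positivity))
  have e : partialEval E x N = ∑ k ∈ range N, PowerSeries.coeff k (lambertSeries 1 (1 / h)) *
      partialEval ((PowerSeries.X * E) ^ k) x N := by
    simp only [partialEval, Finset.mul_sum]
    rw [Finset.sum_comm]
    refine Finset.sum_congr rfl fun n hn => ?_
    nth_rw 1 [hE, ← lambertSeries_eq_subst hh]
    rw [coeff_subst_X_mul _ _ (mem_range.1 hn), Finset.sum_mul]
    exact Finset.sum_congr rfl fun k _ => mul_assoc _ _ _
  rw [e]
  exact Finset.sum_le_sum fun k _ => mul_le_mul_of_nonneg_left (partialEval_pow_le hF hx k N)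
    (coeff_lambertSeries_nonneg le_rfl (by positivity) k)

theorem partialEval_lambertSeries_pow_le {h : ℕ} (hh : 1 ≤ h) {x : ℝ} (hx : 0 ≤ x)
    (hxh : x ^ h ≤ (h : ℝ) ^ h / ((h : ℝ) + 1) ^ (h + 1)) (N : ℕ) :
    partialEval (lambertSeries (((h : ℝ) + 1) / h) (1 / h)) x N ^ h ≤ h + 1 := by
  have ht : 1 ≤ ((h : ℝ) + 1) / h := by
    rw [le_div_iff₀ (by positivity)]; linarith
  have hE := coeff_lambertSeries_nonneg ht (by positivity : (0 : ℝ) ≤ 1 / h)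
  induction N with
  | zero =>
    simp [partialEval, show h ≠ 0 by omega]
    positivity
  | succ N ih =>
    have hle := partialEval_lambertSeries_le_subst hh hx (N + 1)
    rw [partialEval_X_mul] at hle
    set y := x * partialEval (lambertSeries (((h : ℝ) + 1) / h) (1 / h)) x N with hy
    have hy0 : 0 ≤ y := mul_nonneg hx (partialEval_nonneg hE hx N)
    have hyh : y ^ h ≤ ((h : ℝ) / (h + 1)) ^ h := by
      rw [hy, mul_pow]
      calc _ ≤ (h : ℝ) ^ h / ((h : ℝ) + 1) ^ (h + 1) * (h + 1) :=
            mul_le_mul hxh ih (pow_nonneg (partialEval_nonneg hE hx N) _) (by positivity)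
        _ = _ := by rw [div_pow, pow_succ]; field_simp
    have hy1 : y ≤ (h : ℝ) / (h + 1) := le_of_pow_le_pow_left₀ (by omega) (by positivity) hyh
    have hy2 : (1 : ℝ) / (h + 1) ≤ 1 - y := by
      have : (h : ℝ) / (h + 1) + 1 / (h + 1) = 1 := by field_simp
      linarith
    have hp : (0 : ℝ) < 1 / (h + 1) := by positivity
    calc _ ≤ _ := pow_le_pow_left₀ (partialEval_nonneg hE hx _) hle h
      _ ≤ (1 - y)⁻¹ := partialEval_lambertSeries_one_pow_le hh hy0 (by linarith) _
      _ ≤ (1 / ((h : ℝ) + 1))⁻¹ := inv_anti₀ hp hy2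
      _ = h + 1 := by simp

theorem lambertSeries_succ_one (h : ℕ) :
    lambertSeries ((h : ℝ) + 1) 1 =
      1 + PowerSeries.X * lambertSeries ((h : ℝ) + 1) 1 ^ (h + 1) := by
  rw [← lambertSeries_nat_mul]
  push_cast
  rw [mul_one]
  exact lambertSeries_one_eq _

theorem partialEval_lambertSeries_succ_le {h : ℕ} (hh : 1 ≤ h) {x : ℝ} (hx : 0 ≤ x)
    (hxh : x ≤ (h : ℝ) ^ h / ((h : ℝ) + 1) ^ (h + 1)) (N : ℕ) :
    partialEval (lambertSeries ((h : ℝ) + 1) 1) x N ≤ (h + 1) / h := by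
  have h0 : (0 : ℝ) < h := by positivity
  have hA := coeff_lambertSeries_nonneg (t := (h : ℝ) + 1) (by linarith) zero_le_one
  induction N with
  | zero => simp [partialEval]; positivity
  | succ N ih =>
    rw [lambertSeries_succ_one, partialEval_add, partialEval_X_mul, partialEval_one_succ]
    calc _ ≤ 1 + (h : ℝ) ^ h / ((h : ℝ) + 1) ^ (h + 1) * (((h : ℝ) + 1) / h) ^ (h + 1) := by
          refine add_le_add_right (mul_le_mul hxh ?_ (partialEval_nonneg (coeff_pow_nonneg hA _)
            hx N) (by positivity)) 1
          exact (partialEval_pow_le hA hx _ _).trans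
            (pow_le_pow_left₀ (partialEval_nonneg hA hx N) ih _)
      _ = _ := by rw [div_pow, pow_succ (h : ℝ)]; field_simp

theorem summable_lambertSeries_succ {h : ℕ} (hh : 1 ≤ h) {x : ℝ} (hx : 0 ≤ x)
    (hxh : x ≤ (h : ℝ) ^ h / ((h : ℝ) + 1) ^ (h + 1)) :
    Summable fun n => rothe ((h : ℝ) + 1) 1 n * x ^ n := by
  have h0 : (0 : ℝ) < h := by positivity
  simpa only [coeff_lambertSeries] using summable_of_partialEval_le
    (coeff_lambertSeries_nonneg (t := (h : ℝ) + 1) (by linarith) zero_le_one) hx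
    (partialEval_lambertSeries_succ_le hh hx hxh)

theorem partialEval_lambertSeries_le {h : ℕ} (hh : 1 ≤ h) {x : ℝ} (hx : 0 ≤ x)
    (hxh : x ^ h ≤ (h : ℝ) ^ h / ((h : ℝ) + 1) ^ (h + 1)) (N : ℕ) :
    partialEval (lambertSeries (((h : ℝ) + 1) / h) (1 / h)) x N ≤ h + 1 := by
  refine le_of_pow_le_pow_left₀ (n := h) (by omega) (by positivity)
    ((partialEval_lambertSeries_pow_le hh hx hxh N).trans ?_)
  exact le_self_pow₀ (by linarith [(Nat.cast_nonneg h : (0 : ℝ) ≤ h)]) (by omega)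

theorem summable_lambertSeries_inv {h : ℕ} (hh : 1 ≤ h) {x : ℝ} (hx : 0 ≤ x)
    (hxh : x ^ h ≤ (h : ℝ) ^ h / ((h : ℝ) + 1) ^ (h + 1)) :
    Summable fun n => rothe (((h : ℝ) + 1) / h) (1 / h) n * x ^ n := by
  have ht : 1 ≤ ((h : ℝ) + 1) / h := by
    rw [le_div_iff₀ (by positivity)]; linarith
  simpa only [coeff_lambertSeries] using summable_of_partialEval_le
    (coeff_lambertSeries_nonneg ht (by positivity)) hx (partialEval_lambertSeries_le hh hx hxh)

theorem tsum_lambertSeries_inv_pow_le {h : ℕ} (hh : 1 ≤ h) {x : ℝ} (hx : 0 ≤ x)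
    (hxh : x ^ h ≤ (h : ℝ) ^ h / ((h : ℝ) + 1) ^ (h + 1)) :
    (∑' n, rothe (((h : ℝ) + 1) / h) (1 / h) n * x ^ n) ^ h ≤ h + 1 := by
  have := ((summable_lambertSeries_inv hh hx hxh).hasSum.tendsto_sum_nat).pow h
  refine le_of_tendsto' this fun N => ?_
  simpa only [partialEval, coeff_lambertSeries] using
    partialEval_lambertSeries_pow_le hh hx hxh N

/-- The coefficients of `B_t ^ (- 1 / h)` are dominated by those of `B_t ^ (1 / h)`. -/
theorem abs_rothe_neg_le {h : ℕ} (hh : 1 ≤ h) (n : ℕ) :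
    |rothe (((h : ℝ) + 1) / h) (-(1 / h)) n| ≤ rothe (((h : ℝ) + 1) / h) (1 / h) n := by
  set t : ℝ := ((h : ℝ) + 1) / h with ht
  have h0 : (0 : ℝ) < h := by positivity
  have ht1 : t + -(1 / h) = 1 := by rw [ht]; field_simp; ring
  have ht2 : 1 ≤ t := by rw [ht, le_div_iff₀ h0]; linarith
  have hpos : (0 : ℝ) ≤ 1 / h := by positivity
  cases n with
  | zero => simp [rothe]
  | succ n =>
    have hneg : ∀ m, rothe t (-(1 / h)) (m + 1) ≤ 0 :=
      rothe_succ_nonpos ht2 (by linarith) ht1.ge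
    rw [abs_of_nonpos (hneg n)]
    have h1 := sum_antidiagonal_rothe_mul t (n + 1) (-(1 / h)) (1 / h)
    rw [neg_add_cancel, rothe_zero_left_succ, Finset.Nat.sum_antidiagonal_succ] at h1
    have h2 := Finset.single_le_sum (s := antidiagonal n)
      (f := fun p => -(rothe t (-(1 / h)) (p.1 + 1) * rothe t (1 / h) p.2))
      (fun p _ => neg_nonneg.2 (mul_nonpos_of_nonpos_of_nonneg (hneg _)
        (rothe_nonneg ht2 hpos _))) (show (n, 0) ∈ antidiagonal n by simp)
    rw [Finset.sum_neg_distrib] at h2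
    simp only [rothe_zero_right, one_mul, mul_one] at h1 h2
    linarith

/-- The power series that converge absolutely at `x`. -/
def absConvergent (x : ℂ) : Subring (PowerSeries ℂ) where
  carrier := {f | Summable fun n => ‖PowerSeries.coeff n f * x ^ n‖}
  mul_mem' {f g} hf hg := by
    refine (summable_norm_sum_mul_antidiagonal_of_summable_norm hf hg).congr fun n => ?_
    rw [PowerSeries.coeff_mul, Finset.sum_mul]
    refine congrArg norm (Finset.sum_congr rfl fun p hp => ?_)
    rw [← HasAntidiagonal.mem_antidiagonal.1 hp, pow_add]
    ring
  one_mem' := summable_of_ne_finset_zero (s := {0}) fun n hn => by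
    rw [PowerSeries.coeff_one, if_neg (by simpa using hn), zero_mul, norm_zero]
  add_mem' {f g} hf hg := by
    refine Summable.of_nonneg_of_le (fun _ => norm_nonneg _) (fun n => ?_) (hf.add hg)
    rw [map_add, add_mul]
    exact norm_add_le _ _
  zero_mem' := by simp
  neg_mem' {f} hf := by simpa only [Set.mem_ofPred_eq, map_neg, neg_mul, norm_neg] using hf

theorem mem_absConvergent {x : ℂ} {f : PowerSeries ℂ} :
    f ∈ absConvergent x ↔ Summable fun n => ‖PowerSeries.coeff n f * x ^ n‖ := Iff.rfl

/-- Evaluation of the power series that converge absolutely at `x`. -/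
noncomputable def evalAt (x : ℂ) : absConvergent x →+* ℂ where
  toFun f := ∑' n, PowerSeries.coeff n f.1 * x ^ n
  map_one' := by
    rw [tsum_eq_single 0 fun n hn => by
      rw [OneMemClass.coe_one, PowerSeries.coeff_one, if_neg hn, zero_mul]]
    simp
  map_mul' f g := by
    rw [tsum_mul_tsum_eq_tsum_sum_antidiagonal_of_summable_norm f.2 g.2]
    refine tsum_congr fun n => ?_
    rw [Subring.coe_mul, PowerSeries.coeff_mul, Finset.sum_mul]
    refine Finset.sum_congr rfl fun p hp => ?_
    rw [← HasAntidiagonal.mem_antidiagonal.1 hp, pow_add]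
    ring
  map_zero' := by simp
  map_add' f g := by
    rw [← Summable.tsum_add f.2.of_norm g.2.of_norm]
    exact tsum_congr fun n => by rw [Subring.coe_add, map_add, add_mul]

theorem evalAt_apply {x : ℂ} (f : absConvergent x) :
    evalAt x f = ∑' n, PowerSeries.coeff n f.1 * x ^ n := rfl

theorem X_mem_absConvergent (x : ℂ) : PowerSeries.X ∈ absConvergent x :=
  summable_of_ne_finset_zero (s := {1}) fun n hn => by
    rw [PowerSeries.coeff_X, if_neg (by simpa using hn), zero_mul, norm_zero]

theorem evalAt_X (x : ℂ) : evalAt x ⟨PowerSeries.X, X_mem_absConvergent x⟩ = x := by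
  rw [evalAt_apply, tsum_eq_single 1 fun n hn => by rw [PowerSeries.coeff_X, if_neg hn, zero_mul]]
  simp

theorem C_mem_absConvergent (x a : ℂ) : PowerSeries.C a ∈ absConvergent x :=
  summable_of_ne_finset_zero (s := {0}) fun n hn => by
    rw [PowerSeries.coeff_C, if_neg (by simpa using hn), zero_mul, norm_zero]

theorem evalAt_C (x a : ℂ) : evalAt x ⟨PowerSeries.C a, C_mem_absConvergent x a⟩ = a := by
  rw [evalAt_apply, tsum_eq_single 0 fun n hn => by rw [PowerSeries.coeff_C, if_neg hn, zero_mul]]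
  simp

theorem rescale_mem_absConvergent {x a : ℂ} {f : PowerSeries ℂ} (hf : f ∈ absConvergent (a * x)) :
    PowerSeries.rescale a f ∈ absConvergent x := by
  refine hf.congr fun n => ?_
  rw [PowerSeries.coeff_rescale]
  ring_nf

theorem evalAt_rescale {x a : ℂ} {f : PowerSeries ℂ} (hf : f ∈ absConvergent (a * x)) :
    evalAt x ⟨_, rescale_mem_absConvergent hf⟩ = evalAt (a * x) ⟨f, hf⟩ := by
  rw [evalAt_apply, evalAt_apply]
  refine tsum_congr fun n => ?_
  rw [PowerSeries.coeff_rescale]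
  ring

theorem coeff_expand_eq_zero {h : ℕ} (h0 : h ≠ 0) (f : PowerSeries ℂ) {n : ℕ}
    (hn : n ∉ Set.range (h * ·)) : PowerSeries.coeff n (PowerSeries.expand h h0 f) = 0 := by
  rw [PowerSeries.coeff_expand, if_neg]
  rintro ⟨k, rfl⟩
  exact hn ⟨k, rfl⟩

theorem expand_mem_absConvergent {h : ℕ} (h0 : h ≠ 0) {x : ℂ} {f : PowerSeries ℂ}
    (hf : f ∈ absConvergent (x ^ h)) : PowerSeries.expand h h0 f ∈ absConvergent x := by
  rw [mem_absConvergent, ← (mul_right_injective₀ h0).summable_iff fun n hn => by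
    rw [coeff_expand_eq_zero h0 f hn, zero_mul, norm_zero]]
  refine hf.congr fun n => ?_
  simp only [Function.comp_apply]
  rw [PowerSeries.coeff_expand_mul, pow_mul]

theorem evalAt_expand {h : ℕ} (h0 : h ≠ 0) {x : ℂ} {f : PowerSeries ℂ}
    (hf : f ∈ absConvergent (x ^ h)) :
    evalAt x ⟨_, expand_mem_absConvergent h0 hf⟩ = evalAt (x ^ h) ⟨f, hf⟩ := by
  rw [evalAt_apply, evalAt_apply, ← (mul_right_injective₀ h0).tsum_eq fun n hn => by
    by_contra hn'
    refine hn ?_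
    change _ * _ = _
    rw [coeff_expand_eq_zero h0 f hn', zero_mul]]
  refine tsum_congr fun n => ?_
  rw [PowerSeries.coeff_expand_mul, pow_mul]

/-- The power series `B_t ^ r` with complex coefficients. -/
noncomputable def lambertSeriesC (t r : ℝ) : PowerSeries ℂ :=
  PowerSeries.map (algebraMap ℝ ℂ) (lambertSeries t r)

theorem coeff_lambertSeriesC (t r : ℝ) (n : ℕ) :
    PowerSeries.coeff n (lambertSeriesC t r) = (rothe t r n : ℂ) := by
  rw [lambertSeriesC, PowerSeries.coeff_map, coeff_lambertSeries]; rfl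

theorem constantCoeff_lambertSeriesC (t r : ℝ) :
    PowerSeries.constantCoeff (lambertSeriesC t r) = 1 := by
  rw [← PowerSeries.coeff_zero_eq_constantCoeff_apply, coeff_lambertSeriesC, rothe_zero_right,
    Complex.ofReal_one]

theorem mem_absConvergent_lambertSeriesC {t r : ℝ} {x : ℂ} {b : ℕ → ℝ}
    (hb : Summable fun n => b n * ‖x‖ ^ n) (h : ∀ n, |rothe t r n| ≤ b n) :
    lambertSeriesC t r ∈ absConvergent x := by
  refine Summable.of_nonneg_of_le (fun _ => norm_nonneg _) (fun n => ?_) hb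
  rw [coeff_lambertSeriesC, norm_mul, norm_pow, Complex.norm_real, Real.norm_eq_abs]
  exact mul_le_mul_of_nonneg_right (h n) (by positivity)

theorem evalAt_lambertSeriesC {t r : ℝ} (h : ∀ n : ℕ, t * n + r ≠ 0) {x : ℂ}
    (hx : lambertSeriesC t r ∈ absConvergent x) :
    evalAt x ⟨_, hx⟩ = genBinom t r x :=
  tsum_congr fun n => by rw [coeff_lambertSeriesC, genBinomCoeff_eq_rothe (h n)]

theorem summable_genBinomCoeff {t r : ℝ} (h : ∀ n : ℕ, t * n + r ≠ 0) {x : ℂ}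
    (hx : lambertSeriesC t r ∈ absConvergent x) :
    Summable fun n : ℕ => (genBinomCoeff t r n : ℂ) * x ^ n := by
  refine hx.of_norm.congr fun n => ?_
  rw [coeff_lambertSeriesC, genBinomCoeff_eq_rothe (h n)]

theorem lambertSeriesC_succ_one (h : ℕ) :
    lambertSeriesC ((h : ℝ) + 1) 1 =
      1 + PowerSeries.X * lambertSeriesC ((h : ℝ) + 1) 1 ^ (h + 1) := by
  have := congrArg (PowerSeries.map (algebraMap ℝ ℂ)) (lambertSeries_succ_one h)
  simpa only [lambertSeriesC, map_add, map_one, map_mul, map_pow, PowerSeries.map_X] using this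

theorem lambertSeriesC_neg_pow {h : ℕ} (hh : 1 ≤ h) :
    lambertSeriesC (((h : ℝ) + 1) / h) (-(1 / h)) =
      lambertSeriesC (((h : ℝ) + 1) / h) (-(1 / h)) ^ (h + 1) + PowerSeries.X := by
  have h0 : (h : ℝ) ≠ 0 := by positivity
  have h1 := lambertSeries_add_one (((h : ℝ) + 1) / h) (-(((h : ℝ) + 1) / h))
  have e1 : -(((h : ℝ) + 1) / h) + 1 = -(1 / h) := by field_simp; ring
  have e2 : -(((h : ℝ) + 1) / h) = ((h + 1 : ℕ) : ℝ) * -(1 / h) := by push_cast; field_simp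
  rw [neg_add_cancel, lambertSeries_zero, mul_one, e1] at h1
  rw [e2, lambertSeries_nat_mul] at h1
  have := congrArg (PowerSeries.map (algebraMap ℝ ℂ)) h1
  simpa only [lambertSeriesC, map_add, map_one, map_mul, map_pow, PowerSeries.map_X] using this

theorem lambertSeriesC_mul_neg (t r : ℝ) : lambertSeriesC t r * lambertSeriesC t (-r) = 1 := by
  rw [lambertSeriesC, lambertSeriesC, ← map_mul, lambertSeries_mul_neg, map_one]

theorem lambertSeriesC_inv_pow {h : ℕ} (hh : 1 ≤ h) (t : ℝ) :
    lambertSeriesC t (1 / h) ^ h = lambertSeriesC t 1 := by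
  rw [lambertSeriesC, lambertSeriesC, ← map_pow, lambertSeries_inv_pow hh]

theorem eq_prod_X_sub_C_of_monic {R : Type*} [CommRing R] [IsDomain R] {p : Polynomial R} {n : ℕ}
    (hp : p.Monic) (hn : p.natDegree = n) {r : ℕ → R} (hr : ∀ i < n, p.IsRoot (r i))
    (hinj : ∀ i < n, ∀ j < n, r i = r j → i = j) :
    p = ∏ i ∈ range n, (Polynomial.X - Polynomial.C (r i)) := by
  classical
  have hle : (Multiset.range n).map r ≤ p.roots := by
    refine (Multiset.le_iff_subset ?_).2 fun a ha => ?_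
    · exact Multiset.Nodup.map_on (fun i hi j hj => hinj i (Multiset.mem_range.1 hi) j
        (Multiset.mem_range.1 hj)) (Multiset.nodup_range n)
    · obtain ⟨i, hi, rfl⟩ := Multiset.mem_map.1 ha
      exact (Polynomial.mem_roots hp.ne_zero).2 (hr i (Multiset.mem_range.1 hi))
  have heq := Multiset.eq_of_le_of_card_le hle (by
    rw [Multiset.card_map, Multiset.card_range, ← hn]; exact Polynomial.card_roots' p)
  have := Polynomial.prod_multiset_X_sub_C_of_monic_of_roots_card_eq hp (by
    rw [← heq, Multiset.card_map, Multiset.card_range, hn])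
  rw [← this, ← heq, Multiset.map_map]
  rfl

theorem trinomial_eq {R : Type*} [CommRing R] [IsDomain R] {h : ℕ} (hh : 1 ≤ h) {x : R}
    {r : ℕ → R} (hr : ∀ i < h + 1, r i ^ (h + 1) - r i + x = 0)
    (hinj : ∀ i < h + 1, ∀ j < h + 1, r i = r j → i = j) :
    (Polynomial.X ^ (h + 1) - Polynomial.X + Polynomial.C x : Polynomial R) =
      ∏ i ∈ range (h + 1), (Polynomial.X - Polynomial.C (r i)) := by
  have hdeg : (-Polynomial.X + Polynomial.C x : Polynomial R).degree < (h + 1 : ℕ) := by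
    refine (Polynomial.degree_add_le _ _).trans_lt (max_lt ?_ ?_)
    · rw [Polynomial.degree_neg, Polynomial.degree_X]
      exact_mod_cast by omega
    · exact Polynomial.degree_C_le.trans_lt (by exact_mod_cast Nat.succ_pos h)
  have e : (Polynomial.X ^ (h + 1) - Polynomial.X + Polynomial.C x : Polynomial R) =
      Polynomial.X ^ (h + 1) + (-Polynomial.X + Polynomial.C x) := by ring
  refine eq_prod_X_sub_C_of_monic ?_ ?_ (fun i hi => ?_) hinj
  · rw [e]; exact Polynomial.monic_X_pow_add hdeg
  · refine Polynomial.natDegree_eq_of_degree_eq_some ?_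
    rw [e, Polynomial.degree_add_eq_left_of_degree_lt] 
    · exact Polynomial.degree_X_pow _
    · rwa [Polynomial.degree_X_pow]
  · simpa [Polynomial.IsRoot] using hr i hi

section Inverse

variable {h : ℕ} {x : ℂ}

theorem lambert_denominator_ne_zero {h : ℕ} (hh : 1 ≤ h) (n : ℕ) :
    ((h : ℝ) + 1) / h * n + -(1 / h) ≠ 0 := by
  have h0 : (h : ℝ) ≠ 0 := by positivity
  intro h1
  have h2 : ((h : ℝ) + 1) * n = 1 := by
    field_simp at h1
    linarith
  have h3 : (h + 1) * n = 1 := by exact_mod_cast h2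
  have := Nat.eq_one_of_mul_eq_one_right h3
  omega

theorem lambertSeriesC_inv_mem (hh : 1 ≤ h)
    (hx : ‖x‖ ^ h ≤ (h : ℝ) ^ h / ((h : ℝ) + 1) ^ (h + 1)) :
    lambertSeriesC (((h : ℝ) + 1) / h) (1 / h) ∈ absConvergent x := by
  have ht : 1 ≤ ((h : ℝ) + 1) / h := by
    rw [le_div_iff₀ (by positivity)]; linarith
  exact mem_absConvergent_lambertSeriesC (summable_lambertSeries_inv hh (norm_nonneg x) hx)
    fun n => (abs_of_nonneg (rothe_nonneg ht (by positivity) n)).le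

theorem lambertSeriesC_neg_mem (hh : 1 ≤ h)
    (hx : ‖x‖ ^ h ≤ (h : ℝ) ^ h / ((h : ℝ) + 1) ^ (h + 1)) :
    lambertSeriesC (((h : ℝ) + 1) / h) (-(1 / h)) ∈ absConvergent x :=
  mem_absConvergent_lambertSeriesC (summable_lambertSeries_inv hh (norm_nonneg x) hx)
    (abs_rothe_neg_le hh)

theorem lambertSeriesC_one_mem (hh : 1 ≤ h)
    (hx : ‖x‖ ^ h ≤ (h : ℝ) ^ h / ((h : ℝ) + 1) ^ (h + 1)) :
    lambertSeriesC (((h : ℝ) + 1) / h) 1 ∈ absConvergent x := by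
  rw [← lambertSeriesC_inv_pow hh]
  exact pow_mem (lambertSeriesC_inv_mem hh hx) h

theorem lambertSeriesC_succ_mem {y : ℂ} (hh : 1 ≤ h)
    (hy : ‖y‖ ≤ (h : ℝ) ^ h / ((h : ℝ) + 1) ^ (h + 1)) :
    lambertSeriesC ((h : ℝ) + 1) 1 ∈ absConvergent y := by
  have h0 : (0 : ℝ) < h := by positivity
  exact mem_absConvergent_lambertSeriesC (summable_lambertSeries_succ hh (norm_nonneg y) hy)
    fun n => (abs_of_nonneg (rothe_nonneg (by linarith) zero_le_one n)).le

theorem genBinom_neg_eq (hh : 1 ≤ h)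
    (hx : ‖x‖ ^ h ≤ (h : ℝ) ^ h / ((h : ℝ) + 1) ^ (h + 1)) :
    genBinom (((h : ℝ) + 1) / h) (-(1 / h)) x =
      evalAt x ⟨_, lambertSeriesC_neg_mem hh hx⟩ :=
  (evalAt_lambertSeriesC (lambert_denominator_ne_zero hh) _).symm

theorem genBinom_one_eq (hh : 1 ≤ h)
    (hx : ‖x‖ ^ h ≤ (h : ℝ) ^ h / ((h : ℝ) + 1) ^ (h + 1)) :
    genBinom (((h : ℝ) + 1) / h) 1 x = evalAt x ⟨_, lambertSeriesC_one_mem hh hx⟩ :=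
  (evalAt_lambertSeriesC (fun n => by positivity) _).symm

theorem genBinom_neg_trinomial (hh : 1 ≤ h)
    (hx : ‖x‖ ^ h ≤ (h : ℝ) ^ h / ((h : ℝ) + 1) ^ (h + 1)) :
    genBinom (((h : ℝ) + 1) / h) (-(1 / h)) x =
      genBinom (((h : ℝ) + 1) / h) (-(1 / h)) x ^ (h + 1) + x := by
  have h1 : (⟨_, lambertSeriesC_neg_mem hh hx⟩ : absConvergent x) =
      ⟨_, lambertSeriesC_neg_mem hh hx⟩ ^ (h + 1) + ⟨_, X_mem_absConvergent x⟩ :=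
    Subtype.ext (lambertSeriesC_neg_pow hh)
  have h2 := congrArg (evalAt x) h1
  rw [map_add, map_pow, evalAt_X] at h2
  rw [genBinom_neg_eq hh hx]
  exact h2

theorem genBinom_one_mul_pow (hh : 1 ≤ h)
    (hx : ‖x‖ ^ h ≤ (h : ℝ) ^ h / ((h : ℝ) + 1) ^ (h + 1)) :
    genBinom (((h : ℝ) + 1) / h) 1 x * genBinom (((h : ℝ) + 1) / h) (-(1 / h)) x ^ h = 1 := by
  have h1 : (⟨_, lambertSeriesC_one_mem hh hx⟩ * ⟨_, lambertSeriesC_neg_mem hh hx⟩ ^ h :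
      absConvergent x) = 1 := by
    refine Subtype.ext ?_
    change lambertSeriesC _ _ * lambertSeriesC _ _ ^ h = 1
    rw [← lambertSeriesC_inv_pow hh, ← mul_pow, lambertSeriesC_mul_neg, one_pow]
  have h2 := congrArg (evalAt x) h1
  rw [map_mul, map_pow, map_one] at h2
  rw [genBinom_neg_eq hh hx, genBinom_one_eq hh hx]
  exact h2

theorem one_le_norm_genBinom_neg (hh : 1 ≤ h)
    (hx : ‖x‖ ^ h ≤ (h : ℝ) ^ h / ((h : ℝ) + 1) ^ (h + 1)) :
    1 ≤ ((h : ℝ) + 1) * ‖genBinom (((h : ℝ) + 1) / h) (-(1 / h)) x‖ ^ h := by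
  set e := evalAt x ⟨_, lambertSeriesC_inv_mem hh hx⟩ with he
  have h1 : (⟨_, lambertSeriesC_inv_mem hh hx⟩ * ⟨_, lambertSeriesC_neg_mem hh hx⟩ :
      absConvergent x) = 1 := Subtype.ext (lambertSeriesC_mul_neg _ _)
  have h2 := congrArg (evalAt x) h1
  rw [map_mul, map_one, ← genBinom_neg_eq hh hx, ← he] at h2
  have ht : 1 ≤ ((h : ℝ) + 1) / h := by
    rw [le_div_iff₀ (by positivity)]; linarith
  have h3 : ‖e‖ ≤ ∑' n, rothe (((h : ℝ) + 1) / h) (1 / h) n * ‖x‖ ^ n := by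
    rw [he, evalAt_apply]
    refine tsum_of_norm_bounded (summable_lambertSeries_inv hh (norm_nonneg x) hx).hasSum
      fun n => ?_
    rw [coeff_lambertSeriesC, norm_mul, norm_pow, Complex.norm_real, Real.norm_eq_abs,
      abs_of_nonneg (rothe_nonneg ht (by positivity) n)]
  have h4 : ‖e‖ ^ h ≤ h + 1 := (pow_le_pow_left₀ (norm_nonneg e) h3 h).trans
    (tsum_lambertSeries_inv_pow_le hh (norm_nonneg x) hx)
  calc (1 : ℝ) = ‖e‖ ^ h * ‖genBinom (((h : ℝ) + 1) / h) (-(1 / h)) x‖ ^ h := by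
        rw [← mul_pow, ← norm_mul, h2, norm_one, one_pow]
    _ ≤ _ := mul_le_mul_of_nonneg_right h4 (by positivity)

theorem genBinom_neg_pow_mem_slitPlane (hh : 1 ≤ h)
    (hx : ‖x‖ ^ h ≤ (h : ℝ) ^ h / ((h : ℝ) + 1) ^ (h + 1)) :
    genBinom (((h : ℝ) + 1) / h) (-(1 / h)) x ^ h ∈ Complex.slitPlane := by
  set c := genBinom (((h : ℝ) + 1) / h) (-(1 / h)) x with hc
  by_contra hn
  rw [Complex.mem_slitPlane_iff_not_le_zero, not_not] at hn
  obtain ⟨hre, him⟩ := Complex.le_def.1 hn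
  have e1 : c ^ h = ((c ^ h).re : ℂ) := Complex.ext rfl (by simpa using him)
  have e2 : x = c * ((1 - (c ^ h).re : ℝ) : ℂ) := by
    have := genBinom_neg_trinomial hh hx
    rw [← hc] at this
    push_cast
    rw [← e1]
    linear_combination -this
  have h1 := one_le_norm_genBinom_neg hh hx
  rw [← hc] at h1
  have h2 : ‖c‖ ≤ ‖x‖ := by
    rw [e2, norm_mul, Complex.norm_real, Real.norm_eq_abs]
    refine le_mul_of_one_le_right (norm_nonneg c) (le_abs.2 (Or.inl ?_))
    simp only [Complex.zero_re] at hre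
    linarith
  have h3 : ‖c‖ ^ h ≤ _ := (pow_le_pow_left₀ (norm_nonneg c) h2 h).trans hx
  have h4 : ((h : ℝ) + 1) * ((h : ℝ) ^ h / ((h : ℝ) + 1) ^ (h + 1)) < 1 := by
    have : (h : ℝ) ^ h < ((h : ℝ) + 1) ^ h :=
      pow_lt_pow_left₀ (by linarith) (by positivity) (by omega)
    rw [pow_succ, mul_div_assoc', div_lt_one (by positivity)]
    nlinarith [(Nat.cast_nonneg h : (0 : ℝ) ≤ h)]
  have h5 : ((h : ℝ) + 1) * ‖c‖ ^ h ≤ _ := mul_le_mul_of_nonneg_left h3 (by positivity)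
  linarith

theorem continuousOn_genBinom_neg_segment (hh : 1 ≤ h)
    (hx : ‖x‖ ^ h ≤ (h : ℝ) ^ h / ((h : ℝ) + 1) ^ (h + 1)) :
    ContinuousOn (fun s : ℝ => genBinom (((h : ℝ) + 1) / h) (-(1 / h)) (s * x))
      (Set.Icc 0 1) := by
  refine continuousOn_tsum (fun n => by fun_prop)
    (summable_lambertSeries_inv hh (norm_nonneg x) hx) fun n s hs => ?_
  rw [genBinomCoeff_eq_rothe (lambert_denominator_ne_zero hh n), norm_mul, norm_pow,
    Complex.norm_real, norm_mul, Complex.norm_real, Real.norm_eq_abs, Real.norm_eq_abs,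
    abs_of_nonneg hs.1]
  refine mul_le_mul (abs_rothe_neg_le hh n) (pow_le_pow_left₀ (mul_nonneg hs.1 (norm_nonneg x))
    (mul_le_of_le_one_left (norm_nonneg x) hs.2) n) (by have := hs.1; positivity)
    ((abs_nonneg _).trans (abs_rothe_neg_le hh n))

theorem genBinom_apply_zero {t r : ℝ} (hr : r ≠ 0) : genBinom t r 0 = 1 := by
  rw [genBinom, tsum_eq_single 0 fun n hn => by rw [zero_pow hn, mul_zero],
    genBinomCoeff_eq_rothe (by simpa using hr)]
  simp [rothe]

theorem genBinom_neg_eq_cpow (hh : 1 ≤ h)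
    (hx : ‖x‖ ^ h ≤ (h : ℝ) ^ h / ((h : ℝ) + 1) ^ (h + 1)) :
    genBinom (((h : ℝ) + 1) / h) (-(1 / h)) x =
      genBinom (((h : ℝ) + 1) / h) 1 x ^ (-1 / (h : ℂ)) := by
  have h0 : (h : ℂ) ≠ 0 := by exact_mod_cast (by omega : h ≠ 0)
  set c : ℝ → ℂ := fun s => genBinom (((h : ℝ) + 1) / h) (-(1 / h)) (s * x) with hc
  have hsx : ∀ s ∈ Set.Icc (0 : ℝ) 1,
      ‖(s : ℂ) * x‖ ^ h ≤ (h : ℝ) ^ h / ((h : ℝ) + 1) ^ (h + 1) := fun s hs => by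
    refine le_trans (pow_le_pow_left₀ (norm_nonneg _) ?_ h) hx
    rw [norm_mul, Complex.norm_real, Real.norm_eq_abs, abs_of_nonneg hs.1]
    exact mul_le_of_le_one_left (norm_nonneg x) hs.2
  have hcont : ContinuousOn c (Set.Icc 0 1) := continuousOn_genBinom_neg_segment hh hx
  have hslit : ∀ s ∈ Set.Icc (0 : ℝ) 1, c s ^ h ∈ Complex.slitPlane := fun s hs =>
    genBinom_neg_pow_mem_slitPlane hh (hsx s hs)
  have hne : ∀ s ∈ Set.Icc (0 : ℝ) 1, c s ≠ 0 := fun s hs h1 => by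
    have := Complex.slitPlane_ne_zero (hslit s hs)
    rw [h1, zero_pow (by omega)] at this
    exact this rfl
  set q : ℝ → ℂ := fun s => (c s ^ h) ^ (1 / (h : ℂ)) / c s with hq
  have hqc : ContinuousOn q (Set.Icc 0 1) :=
    ((hcont.pow h).cpow continuousOn_const hslit).div hcont hne
  have hqT : Set.MapsTo q (Set.Icc 0 1) {z : ℂ | z ^ h = 1} := fun s hs => by
    change (_ / _) ^ h = 1
    rw [div_pow, one_div, Complex.cpow_nat_inv_pow _ (by omega),
      div_self (pow_ne_zero _ (hne s hs))]
  have hfin : {z : ℂ | z ^ h = 1}.Finite := by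
    refine (Polynomial.nthRoots h (1 : ℂ)).toFinset.finite_toSet.subset fun z hz => ?_
    simpa [Polynomial.mem_nthRoots (by omega : 0 < h)] using hz
  have hdisc := hfin.isDiscrete
  have hconst := isPreconnected_Icc.constant_of_mapsTo hdisc hqc hqT
    (Set.right_mem_Icc.2 zero_le_one) (Set.left_mem_Icc.2 zero_le_one)
  have hq0 : q 0 = 1 := by
    have : c 0 = 1 := by
      rw [hc]
      simp only [Complex.ofReal_zero, zero_mul]
      exact genBinom_apply_zero (by have : (h : ℝ) ≠ 0 := by positivity
                                    simpa using by omega)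
    simp [hq, this]
  rw [hq0] at hconst
  have h1 : (c 1 ^ h) ^ (1 / (h : ℂ)) = c 1 :=
    (div_eq_one_iff_eq (hne 1 (Set.right_mem_Icc.2 zero_le_one))).1 hconst
  have hc1 : c 1 = genBinom (((h : ℝ) + 1) / h) (-(1 / h)) x := by simp [hc]
  have hs1 := hslit 1 (Set.right_mem_Icc.2 zero_le_one)
  rw [hc1] at h1 hs1
  rw [eq_inv_of_mul_eq_one_left (genBinom_one_mul_pow hh hx), neg_div, Complex.cpow_neg,
    Complex.inv_cpow _ _ (Complex.mem_slitPlane_iff_arg.1 hs1).1, inv_inv, h1]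

end Inverse

/-- The roots of `z ^ (h + 1) - z + X` in `ℂ⟦X⟧`. -/
noncomputable def rootSeries (h : ℕ) (h0 : h ≠ 0) (ζ : ℂ) (j : ℕ) : PowerSeries ℂ :=
  if j < h then
    PowerSeries.C (ζ ^ j)⁻¹ *
      PowerSeries.rescale (ζ ^ j) (lambertSeriesC (((h : ℝ) + 1) / h) (-(1 / h)))
  else PowerSeries.X * PowerSeries.expand h h0 (lambertSeriesC ((h : ℝ) + 1) 1)

theorem rootSeries_trinomial {h : ℕ} (hh : 1 ≤ h) {ζ : ℂ} (hζ : IsPrimitiveRoot ζ h) (j : ℕ) :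
    rootSeries h (by omega) ζ j ^ (h + 1) - rootSeries h (by omega) ζ j + PowerSeries.X = 0 := by
  unfold rootSeries
  split_ifs with hj
  · have h1 := congrArg (PowerSeries.rescale (ζ ^ j)) (lambertSeriesC_neg_pow hh)
    rw [map_add, map_pow, PowerSeries.rescale_X] at h1
    set f := PowerSeries.rescale (ζ ^ j) (lambertSeriesC (((h : ℝ) + 1) / h) (-(1 / h)))
    have hζ0 : ζ ^ j ≠ 0 := pow_ne_zero _ (hζ.ne_zero (by omega))
    have h2 : ((ζ ^ j)⁻¹) ^ (h + 1) = (ζ ^ j)⁻¹ := by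
      rw [pow_succ, inv_pow, ← pow_mul, mul_comm j h, pow_mul, hζ.pow_eq_one, one_pow, inv_one,
        one_mul]
    have h3 : PowerSeries.C (ζ ^ j)⁻¹ * PowerSeries.C (ζ ^ j) = 1 := by
      rw [← map_mul, inv_mul_cancel₀ hζ0, map_one]
    rw [mul_pow, ← map_pow, h2]
    linear_combination (-PowerSeries.C (ζ ^ j)⁻¹) * h1 - PowerSeries.X * h3
  · have h1 := congrArg (PowerSeries.expand h (by omega)) (lambertSeriesC_succ_one h)
    rw [map_add, map_mul, map_pow, map_one, PowerSeries.expand_X] at h1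
    linear_combination (-PowerSeries.X) * h1

theorem constantCoeff_rootSeries {h : ℕ} (h0 : h ≠ 0) (ζ : ℂ) (j : ℕ) :
    PowerSeries.constantCoeff (rootSeries h h0 ζ j) = if j < h then (ζ ^ j)⁻¹ else 0 := by
  unfold rootSeries
  split_ifs
  · rw [map_mul, PowerSeries.constantCoeff_C, ← PowerSeries.coeff_zero_eq_constantCoeff_apply,
      PowerSeries.coeff_rescale, PowerSeries.coeff_zero_eq_constantCoeff_apply,
      constantCoeff_lambertSeriesC, pow_zero, mul_one, mul_one]
  · rw [map_mul, PowerSeries.constantCoeff_X, zero_mul]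

theorem rootSeries_injOn {h : ℕ} (h0 : h ≠ 0) {ζ : ℂ} (hζ : IsPrimitiveRoot ζ h) {i j : ℕ}
    (hi : i < h + 1) (hj : j < h + 1) (hij : rootSeries h h0 ζ i = rootSeries h h0 ζ j) :
    i = j := by
  have h1 := congrArg PowerSeries.constantCoeff hij
  rw [constantCoeff_rootSeries, constantCoeff_rootSeries] at h1
  have hne : ∀ k, (ζ ^ k)⁻¹ ≠ 0 := fun k => inv_ne_zero (pow_ne_zero _ (hζ.ne_zero h0))
  split_ifs at h1 with h2 h3 h3
  · exact hζ.pow_inj h2 h3 (inv_injective h1)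
  · exact absurd h1 (hne i)
  · exact absurd h1.symm (hne j)
  · omega

theorem evalAt_mul {x : ℂ} {f g : PowerSeries ℂ} (hf : f ∈ absConvergent x)
    (hg : g ∈ absConvergent x) (hfg : f * g ∈ absConvergent x) :
    evalAt x ⟨f * g, hfg⟩ = evalAt x ⟨f, hf⟩ * evalAt x ⟨g, hg⟩ := by
  rw [← map_mul, MulMemClass.mk_mul_mk]

section Roots

variable {h : ℕ} {ζ w : ℂ}

theorem norm_pow_eq (w : ℂ) (h : ℕ) : ‖w ^ (h + 1)‖ ^ h = ‖w ^ h‖ ^ (h + 1) := by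
  rw [← norm_pow, ← norm_pow, ← pow_mul, ← pow_mul, mul_comm]

theorem norm_rescaled_pow_eq (h0 : h ≠ 0) (hζ : IsPrimitiveRoot ζ h) (j : ℕ) :
    ‖ζ ^ j * w ^ (h + 1)‖ ^ h = ‖w ^ h‖ ^ (h + 1) := by
  rw [norm_mul, norm_pow ζ, hζ.norm'_eq_one h0, one_pow, one_mul, norm_pow_eq]

theorem exists_evalAt_rootSeries (hh : 1 ≤ h) (hζ : IsPrimitiveRoot ζ h) (hw : w ≠ 0)
    (hb : ‖w ^ h‖ ^ (h + 1) ≤ (h : ℝ) ^ h / ((h : ℝ) + 1) ^ (h + 1)) (j : ℕ) :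
    ∃ hm : rootSeries h (by omega) ζ j ∈ absConvergent (w ^ (h + 1)),
      evalAt (w ^ (h + 1)) ⟨_, hm⟩ = w * lambertRoot h ζ (w ^ h) w j := by
  have h0 : h ≠ 0 := by omega
  unfold rootSeries lambertRoot
  split_ifs with hj
  · have hx : ‖ζ ^ j * w ^ (h + 1)‖ ^ h ≤ _ := (norm_rescaled_pow_eq h0 hζ j).trans_le hb
    have hm := lambertSeriesC_neg_mem hh hx
    refine ⟨(absConvergent _).mul_mem (C_mem_absConvergent _ _) (rescale_mem_absConvergent hm), ?_⟩
    rw [neg_div, genBinom_neg_eq hh hx, ← evalAt_rescale hm]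
    rw [evalAt_mul (C_mem_absConvergent _ _) (rescale_mem_absConvergent hm), evalAt_C]
    field_simp
  · have e : (w ^ (h + 1)) ^ h = (w ^ h) ^ (h + 1) := by rw [← pow_mul, ← pow_mul, mul_comm]
    have hm : lambertSeriesC ((h : ℝ) + 1) 1 ∈ absConvergent ((w ^ (h + 1)) ^ h) :=
      lambertSeriesC_succ_mem hh (by rwa [e, norm_pow])
    refine ⟨(absConvergent _).mul_mem (X_mem_absConvergent _) (expand_mem_absConvergent h0 hm), ?_⟩
    rw [evalAt_mul (X_mem_absConvergent _) (expand_mem_absConvergent h0 hm), evalAt_X,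
      evalAt_expand h0 hm, evalAt_lambertSeriesC (fun n => by positivity) hm, e]
    ring

theorem trinomial_eq_prod_lambertRoot (hh : 1 ≤ h) (hζ : IsPrimitiveRoot ζ h) (hw : w ≠ 0)
    (hb : ‖w ^ h‖ ^ (h + 1) ≤ (h : ℝ) ^ h / ((h : ℝ) + 1) ^ (h + 1)) :
    (1 - Polynomial.C (w ^ h)⁻¹ * Polynomial.X + Polynomial.X ^ (h + 1) : Polynomial ℂ) =
      ∏ i ∈ range (h + 1), (Polynomial.X - Polynomial.C (lambertRoot h ζ (w ^ h) w i)) := by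
  choose hm hev using exists_evalAt_rootSeries hh hζ hw hb
  generalize hx : w ^ (h + 1) = x at hm hev
  have h1 := trinomial_eq hh (x := (⟨_, X_mem_absConvergent x⟩ : absConvergent x))
    (r := fun j => ⟨_, hm j⟩) (fun i _ => Subtype.ext (rootSeries_trinomial hh hζ i))
    (fun i hi j hj hij => rootSeries_injOn _ hζ hi hj (congrArg Subtype.val hij))
  have h2 := congrArg (fun p => (p.map (evalAt x)).comp (Polynomial.C w * Polynomial.X)) h1
  simp only [Polynomial.map_add, Polynomial.map_sub, Polynomial.map_pow, Polynomial.map_X,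
    Polynomial.map_C, evalAt_X, Polynomial.map_prod, hev, Polynomial.add_comp,
    Polynomial.sub_comp, Polynomial.pow_comp, Polynomial.X_comp, Polynomial.C_comp,
    Polynomial.prod_comp, map_mul, Polynomial.mul_comp, ← mul_sub] at h2
  rw [Finset.prod_mul_distrib, Finset.prod_const, Finset.card_range] at h2
  refine mul_left_cancel₀ (pow_ne_zero (h + 1) (Polynomial.C_ne_zero.2 hw)) (Eq.trans ?_ h2)
  have h3 : (Polynomial.C w ^ (h + 1) * Polynomial.C (w ^ h)⁻¹ : Polynomial ℂ) =
      Polynomial.C w := by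
    rw [← map_pow, ← map_mul, pow_succ]
    congr 1
    field_simp
  rw [← hx, map_pow]
  linear_combination (-Polynomial.X) * h3

theorem roots_trinomial (hh : 1 ≤ h) (hζ : IsPrimitiveRoot ζ h) (hw : w ≠ 0)
    (hb : ‖w ^ h‖ ^ (h + 1) ≤ (h : ℝ) ^ h / ((h : ℝ) + 1) ^ (h + 1)) :
    (1 - Polynomial.C (w ^ h)⁻¹ * Polynomial.X + Polynomial.X ^ (h + 1) : Polynomial ℂ).roots =
      (Multiset.range (h + 1)).map (lambertRoot h ζ (w ^ h) w) := by
  rw [trinomial_eq_prod_lambertRoot hh hζ hw hb]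
  have := Polynomial.roots_multiset_prod_X_sub_C
    ((Multiset.range (h + 1)).map (lambertRoot h ζ (w ^ h) w))
  rw [Multiset.map_map] at this
  exact this

end Roots

theorem succ_pow_succ_lt {h : ℕ} (hh : 2 ≤ h) : (h + 1) ^ (h + 1) < 2 ^ (h + 1) * h ^ h := by
  induction h, hh using Nat.le_induction with
  | base => norm_num
  | succ h hh ih =>
    have hpos : 0 < h ^ h := pow_pos (by omega) h
    refine lt_of_mul_lt_mul_right ?_ hpos.le
    calc (h + 1 + 1) ^ (h + 1 + 1) * h ^ h = ((h + 2) * h) ^ h * (h + 2) ^ 2 := by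
          rw [mul_pow, show h + 1 + 1 = h + 2 from rfl]; ring
      _ ≤ ((h + 1) ^ 2) ^ h * (2 * (h + 1) ^ 2) :=
          Nat.mul_le_mul (Nat.pow_le_pow_left (by nlinarith) h) (by nlinarith)
      _ = 2 * (h + 1) ^ (h + 1) * (h + 1) ^ (h + 1) := by rw [← pow_mul]; ring
      _ < 2 * (h + 1) ^ (h + 1) * (2 ^ (h + 1) * h ^ h) :=
          Nat.mul_lt_mul_of_pos_left ih (by positivity)
      _ = _ := by ring

theorem norm_half_pow_le {h : ℕ} (hh : 1 ≤ h) :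
    ‖(1 / 2 : ℂ)‖ ^ (h + 1) ≤ (h : ℝ) ^ h / ((h : ℝ) + 1) ^ (h + 1) := by
  have h1 : (h + 1) ^ (h + 1) ≤ 2 ^ (h + 1) * h ^ h := by
    rcases hh.eq_or_lt with rfl | h2
    · norm_num
    · exact (succ_pow_succ_lt h2).le
  have h2 : ((h : ℝ) + 1) ^ (h + 1) ≤ 2 ^ (h + 1) * (h : ℝ) ^ h := by exact_mod_cast h1
  rw [norm_div, norm_one, RCLike.norm_ofNat, div_pow, one_pow,
    div_le_div_iff₀ (by positivity) (by positivity)]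
  linarith

theorem nodup_roots_trinomial {h : ℕ} (hh : 2 ≤ h) :
    (1 - Polynomial.C 2 * Polynomial.X + Polynomial.X ^ (h + 1) : Polynomial ℂ).roots.Nodup := by
  set p := (1 - Polynomial.C 2 * Polynomial.X + Polynomial.X ^ (h + 1) : Polynomial ℂ) with hp
  have hp0 : p ≠ 0 := fun h0 => by
    have := congrArg (Polynomial.eval 0) h0
    simp [hp] at this
  rw [Multiset.nodup_iff_count_le_one]
  intro a
  rw [Polynomial.count_roots]
  by_contra! hc
  obtain ⟨h1, h2⟩ := (Polynomial.one_lt_rootMultiplicity_iff_isRoot hp0).1 hc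
  have e1 : a ^ h * (h + 1) = 2 := by
    simp [hp, Polynomial.IsRoot] at h1 h2
    linear_combination h2
  have e2 : 1 - 2 * a + a ^ (h + 1) = 0 := by
    simp [hp, Polynomial.IsRoot] at h1 h2
    linear_combination h1
  have e3 : a * (2 * h) = h + 1 := by
    rw [pow_succ] at e2
    linear_combination (-(h + 1 : ℂ)) * e2 + a * e1
  have e4 : ((2 ^ (h + 1) * h ^ h : ℕ) : ℂ) = ((h + 1) ^ (h + 1) : ℕ) := by
    push_cast
    rw [pow_succ (h + 1 : ℂ) h, ← e3, mul_pow, mul_pow, e3]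
    linear_combination -(2 : ℂ) ^ h * h ^ h * e1
  exact (succ_pow_succ_lt hh).ne (Nat.cast_injective e4).symm

section PartialFractions

variable {K : Type*} [Field K]

theorem PowerSeries.inv_X_sub_C {a : K} (ha : a ≠ 0) :
    (PowerSeries.X - PowerSeries.C a : PowerSeries K)⁻¹ =
      PowerSeries.mk fun n => -(a ^ (n + 1))⁻¹ := by
  symm
  rw [PowerSeries.eq_inv_iff_mul_eq_one (by simpa using ha), mul_sub]
  ext n
  rw [map_sub, PowerSeries.coeff_mul_C, PowerSeries.coeff_mk, PowerSeries.coeff_one]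
  cases n with
  | zero => simp [ha]
  | succ n =>
    rw [PowerSeries.coeff_succ_mul_X, PowerSeries.coeff_mk, if_neg (by omega)]
    field_simp
    ring

theorem sum_prod_inv_mul_prod_X_sub_C {s : Finset ℕ} {r : ℕ → K} (hr : Set.InjOn r s)
    (hs : s.Nonempty) :
    ∑ i ∈ s, Polynomial.C (∏ j ∈ s.erase i, (r i - r j)⁻¹) *
      ∏ j ∈ s.erase i, (Polynomial.X - Polynomial.C (r j)) = 1 := by
  rw [← Lagrange.sum_basis hr hs]
  refine Finset.sum_congr rfl fun i _ => ?_
  simp only [Lagrange.basis, Lagrange.basisDivisor, Finset.prod_mul_distrib, map_prod]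

theorem inv_prod_X_sub_C {s : Finset ℕ} {r : ℕ → K} (hr : Set.InjOn r s) (hs : s.Nonempty)
    (h0 : ∀ i ∈ s, r i ≠ 0) :
    (∏ i ∈ s, (PowerSeries.X - PowerSeries.C (r i)) : PowerSeries K)⁻¹ =
      ∑ i ∈ s, PowerSeries.C (∏ j ∈ s.erase i, (r i - r j)⁻¹) *
        (PowerSeries.X - PowerSeries.C (r i))⁻¹ := by
  symm
  rw [PowerSeries.eq_inv_iff_mul_eq_one (by
    rw [map_prod]
    exact Finset.prod_ne_zero_iff.2 fun i hi => by simpa using h0 i hi)]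
  have h1 := congrArg (Polynomial.coeToPowerSeries.ringHom (R := K))
    (sum_prod_inv_mul_prod_X_sub_C hr hs)
  simp only [map_sum, map_mul, map_prod, map_sub, map_one,
    Polynomial.coeToPowerSeries.ringHom_apply, Polynomial.coe_C, Polynomial.coe_X] at h1
  rw [← h1, Finset.sum_mul]
  refine Finset.sum_congr rfl fun i hi => ?_
  rw [← Finset.mul_prod_erase s _ hi, map_prod, mul_assoc, ← mul_assoc (_ : PowerSeries K)⁻¹,
    PowerSeries.inv_mul_cancel _ (by simpa using h0 i hi), one_mul]

theorem coeff_inv_prod_X_sub_C {s : Finset ℕ} {r : ℕ → K} (hr : Set.InjOn r s) (hs : s.Nonempty)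
    (h0 : ∀ i ∈ s, r i ≠ 0) (n : ℕ) :
    PowerSeries.coeff n (∏ i ∈ s, (PowerSeries.X - PowerSeries.C (r i)) : PowerSeries K)⁻¹ =
      -∑ i ∈ s, (r i ^ (n + 1))⁻¹ * ∏ j ∈ s.erase i, (r i - r j)⁻¹ := by
  rw [inv_prod_X_sub_C hr hs h0, map_sum, ← Finset.sum_neg_distrib]
  refine Finset.sum_congr rfl fun i hi => ?_
  rw [PowerSeries.coeff_C_mul, PowerSeries.inv_X_sub_C (h0 i hi), PowerSeries.coeff_mk]
  ring

end PartialFractions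

theorem genFib_add_two (h n : ℕ) :
    genFib h (n + 2) = ∑ k ∈ range (min h (n + 2)), genFib h (n + 1 - k) := by
  rw [genFib, Finset.sum_range]

theorem genFib_add_three {h : ℕ} (hh : 1 ≤ h) (n : ℕ) :
    genFib h (n + 3) + (if h + 1 ≤ n + 3 then genFib h (n + 3 - (h + 1)) else 0) =
      2 * genFib h (n + 2) := by
  rw [genFib_add_two h (n + 1)]
  obtain ⟨m, rfl⟩ : ∃ m, h = m + 1 := ⟨h - 1, by omega⟩
  split_ifs with hn
  · have h1 := genFib_add_two (m + 1) n
    rw [min_eq_left (by omega), Finset.sum_range_succ] at h1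
    rw [min_eq_left (by omega), Finset.sum_range_succ']
    simp only [show ∀ k, n + 1 + 1 - (k + 1) = n + 1 - k from fun k => by omega,
      show n + 3 - (m + 1 + 1) = n + 1 - m by omega, Nat.sub_zero,
      show n + 1 + 1 = n + 2 from rfl]
    omega
  · have h1 := genFib_add_two (m + 1) n
    rw [min_eq_right (by omega)] at h1
    rw [min_eq_right (by omega), Finset.sum_range_succ']
    simp only [show ∀ k, n + 1 + 1 - (k + 1) = n + 1 - k from fun k => by omega, Nat.sub_zero,
      show n + 1 + 1 = n + 2 from rfl]
    omega

theorem mk_genFib_mul {h : ℕ} (hh : 2 ≤ h) :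
    (PowerSeries.mk fun n => (genFib h n : ℂ)) *
      (1 - PowerSeries.C 2 * PowerSeries.X + PowerSeries.X ^ (h + 1)) =
        PowerSeries.X - PowerSeries.X ^ 2 := by
  have e : (PowerSeries.mk fun n => (genFib h n : ℂ)) *
      (1 - PowerSeries.C 2 * PowerSeries.X + PowerSeries.X ^ (h + 1)) =
      (PowerSeries.mk fun n => (genFib h n : ℂ)) -
        PowerSeries.C 2 * (PowerSeries.X * PowerSeries.mk fun n => (genFib h n : ℂ)) +
        PowerSeries.X ^ (h + 1) * PowerSeries.mk fun n => (genFib h n : ℂ) := by ring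
  rw [e]
  ext n
  rw [map_add, map_sub, map_sub, PowerSeries.coeff_C_mul, PowerSeries.coeff_X_pow_mul',
    PowerSeries.coeff_X, PowerSeries.coeff_X_pow]
  match n with
  | 0 => simp [genFib]
  | 1 =>
    rw [PowerSeries.coeff_succ_X_mul, if_neg (by omega)]
    simp [genFib]
  | 2 =>
    rw [PowerSeries.coeff_succ_X_mul, if_neg (by omega)]
    have : genFib h 2 = 1 := by
      rw [genFib_add_two, min_eq_right (by omega)]
      simp [Finset.sum_range_succ, genFib]
    simp [genFib, this]
    norm_num
  | n + 3 =>
    rw [PowerSeries.coeff_succ_X_mul]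
    have h1 := congrArg (Nat.cast (R := ℂ)) (genFib_add_three (by omega : 1 ≤ h) n)
    simp only [PowerSeries.coeff_mk]
    push_cast at h1
    rw [if_neg (by omega : ¬n + 3 = 1), if_neg (by omega : ¬n + 3 = 2)]
    push_cast
    linear_combination h1

theorem genFib_eq_sum {h : ℕ} (hh : 2 ≤ h) {r : ℕ → ℂ} (hr : Set.InjOn r (range (h + 1)))
    (h0 : ∀ i ∈ range (h + 1), r i ≠ 0)
    (hc : ∀ n : ℕ, PowerSeries.coeff n
        ((1 - PowerSeries.C 2 * PowerSeries.X + PowerSeries.X ^ (h + 1) : PowerSeries ℂ)⁻¹) =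
        -∑ i ∈ range (h + 1),
          (r i ^ (n + 1))⁻¹ * ∏ j ∈ (range (h + 1)).erase i, (r i - r j)⁻¹) (n : ℕ) :
    (genFib h n : ℂ) =
      ∑ i ∈ range (h + 1),
        (r i - 1) * (r i ^ n)⁻¹ * ∏ j ∈ (range (h + 1)).erase i, (r i - r j)⁻¹ := by
  obtain ⟨W, hW⟩ : ∃ W : ℕ → ℂ, ∀ i, ∏ j ∈ (range (h + 1)).erase i, (r i - r j)⁻¹ = W i :=
    ⟨_, fun _ => rfl⟩
  simp only [hW] at hc ⊢
  set P := (1 - PowerSeries.C 2 * PowerSeries.X + PowerSeries.X ^ (h + 1) : PowerSeries ℂ) with hP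
  have hsum : ∀ p : Polynomial ℂ, p.natDegree < h → ∑ i ∈ range (h + 1), p.eval (r i) * W i = 0 := by
    intro p hp
    have h1 := Lagrange.coeff_eq_sum hr (P := p) (by
      rw [card_range]
      exact (Polynomial.degree_le_natDegree).trans_lt (by exact_mod_cast by omega))
    rw [card_range, Nat.add_sub_cancel, Polynomial.coeff_eq_zero_of_natDegree_lt hp] at h1
    rw [h1]
    exact Finset.sum_congr rfl fun i _ => by
      rw [div_eq_mul_inv, ← Finset.prod_inv_distrib, hW]
  have hW0 : ∑ i ∈ range (h + 1), W i = 0 := by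
    simpa using hsum 1 (by simp; omega)
  have hW1 : ∑ i ∈ range (h + 1), r i * W i = 0 := by
    simpa using hsum Polynomial.X (by simp; omega)
  have hP0 : PowerSeries.constantCoeff P ≠ 0 := by simp [hP]
  have hU : (PowerSeries.mk fun n => (genFib h n : ℂ)) =
      PowerSeries.X * P⁻¹ - PowerSeries.X ^ 2 * P⁻¹ := by
    rw [← sub_mul, ← mk_genFib_mul hh, mul_assoc, PowerSeries.mul_inv_cancel _ hP0, mul_one]
  have hUn := congrArg (PowerSeries.coeff n) hU
  rw [PowerSeries.coeff_mk, map_sub, PowerSeries.coeff_X_pow_mul'] at hUn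
  rw [hUn]
  match n with
  | 0 =>
    simp only [pow_zero, inv_one, mul_one, sub_mul, one_mul, Finset.sum_sub_distrib, hW0, hW1]
    simp
  | 1 =>
    rw [PowerSeries.coeff_succ_X_mul, if_neg (by omega), hc, sub_zero, ← Finset.sum_neg_distrib,
      ← add_zero (∑ i ∈ _, _), ← hW0, ← Finset.sum_add_distrib]
    refine Finset.sum_congr rfl fun i hi => ?_
    have := h0 i hi
    field_simp
    ring
  | n + 2 =>
    rw [PowerSeries.coeff_succ_X_mul, if_pos (by omega), hc, hc, ← Finset.sum_neg_distrib,
      ← Finset.sum_neg_distrib, ← Finset.sum_sub_distrib]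
    refine Finset.sum_congr rfl fun i hi => ?_
    have := h0 i hi
    rw [Nat.add_sub_cancel]
    field_simp
    ring

theorem mainTheorem3 :
    -- the roots, with multiplicity, wherever the series converge
    (∀ (h : ℕ) (ζ u w : ℂ), 1 ≤ h → IsPrimitiveRoot ζ h → u ≠ 0 → w ^ h = u →
      ‖u‖ ^ (h + 1) ≤ (h : ℝ) ^ h / ((h : ℝ) + 1) ^ (h + 1) →
      (Summable fun n : ℕ => (genBinomCoeff ((h : ℝ) + 1) 1 n : ℂ) * (u ^ (h + 1)) ^ n) ∧
      (∀ j < h,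
        (Summable fun n : ℕ =>
          (genBinomCoeff (((h : ℝ) + 1) / h) 1 n : ℂ) * (ζ ^ j * w ^ (h + 1)) ^ n) ∧
        (Summable fun n : ℕ =>
          (genBinomCoeff (((h : ℝ) + 1) / h) (-1 / (h : ℝ)) n : ℂ) *
            (ζ ^ j * w ^ (h + 1)) ^ n) ∧
        genBinom (((h : ℝ) + 1) / h) (-1 / (h : ℝ)) (ζ ^ j * w ^ (h + 1)) =
          genBinom (((h : ℝ) + 1) / h) 1 (ζ ^ j * w ^ (h + 1)) ^ (-1 / (h : ℂ))) ∧
      (1 - Polynomial.C u⁻¹ * Polynomial.X + Polynomial.X ^ (h + 1) : Polynomial ℂ).roots =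
        (Multiset.range (h + 1)).map (lambertRoot h ζ u w)) ∧
    -- the value `u = 1 / 2` is admissible
    (∀ h : ℕ, 1 ≤ h →
      ‖(1 / 2 : ℂ)‖ ^ (h + 1) ≤ (h : ℝ) ^ h / ((h : ℝ) + 1) ^ (h + 1)) ∧
    -- partial fractions and the Binet-type formula
    (∀ (h : ℕ) (ζ w : ℂ), 2 ≤ h → IsPrimitiveRoot ζ h → w ^ h = 1 / 2 →
      ∀ r : ℕ → ℂ, r = lambertRoot h ζ (1 / 2) w →
      (∀ i ∈ range (h + 1), r i ≠ 0) ∧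
      (∀ i ∈ range (h + 1), ∀ j ∈ range (h + 1), r i = r j → i = j) ∧
      ((1 - PowerSeries.C 2 * PowerSeries.X + PowerSeries.X ^ (h + 1) : PowerSeries ℂ)⁻¹ =
        ∑ i ∈ range (h + 1),
          PowerSeries.C (∏ j ∈ (range (h + 1)).erase i, (r i - r j)⁻¹) *
            (PowerSeries.X - PowerSeries.C (r i))⁻¹) ∧
      (∀ n : ℕ,
        PowerSeries.coeff n
          ((1 - PowerSeries.C 2 * PowerSeries.X + PowerSeries.X ^ (h + 1) : PowerSeries ℂ)⁻¹) =
        -∑ i ∈ range (h + 1),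
          (r i ^ (n + 1))⁻¹ * ∏ j ∈ (range (h + 1)).erase i, (r i - r j)⁻¹) ∧
      (∀ n : ℕ,
        (genFib h n : ℂ) =
          ∑ i ∈ range (h + 1),
            (r i - 1) * (r i ^ n)⁻¹ * ∏ j ∈ (range (h + 1)).erase i, (r i - r j)⁻¹)) := by

  refine ⟨fun h ζ u w hh hζ hu hw hb => ?_, fun h hh => norm_half_pow_le hh,
    fun h ζ w hh hζ hw r hr => ?_⟩
  · subst hw
    have hw0 : w ≠ 0 := fun h0 => hu (by rw [h0, zero_pow (by omega)])
    refine ⟨summable_genBinomCoeff (fun n => by positivity)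
      (lambertSeriesC_succ_mem hh (by rwa [norm_pow])), fun j hj => ?_,
      roots_trinomial hh hζ hw0 hb⟩
    have hx := (norm_rescaled_pow_eq (w := w) (by omega) hζ j).trans_le hb
    rw [neg_div]
    exact ⟨summable_genBinomCoeff (fun n => by positivity) (lambertSeriesC_one_mem hh hx),
      summable_genBinomCoeff (lambert_denominator_ne_zero hh) (lambertSeriesC_neg_mem hh hx),
      genBinom_neg_eq_cpow hh hx⟩
  · have hw0 : w ≠ 0 := fun h0 => by
      rw [h0, zero_pow (by omega)] at hw
      norm_num at hw
    have hb := norm_half_pow_le (by omega : 1 ≤ h)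
    have hu : (1 / 2 : ℂ)⁻¹ = 2 := by norm_num
    rw [← hw] at hb hr hu
    have hprod := trinomial_eq_prod_lambertRoot (by omega) hζ hw0 hb
    have hroots := roots_trinomial (by omega) hζ hw0 hb
    rw [hu, ← hr] at hprod hroots
    have hnodup := nodup_roots_trinomial hh
    rw [hroots] at hnodup
    have hinj : ∀ i ∈ range (h + 1), ∀ j ∈ range (h + 1), r i = r j → i = j :=
      fun i hi j hj => Multiset.inj_on_of_nodup_map hnodup i hi j hj
    have hr0 : ∀ i ∈ range (h + 1), r i ≠ 0 := fun i hi h0 => by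
      have h1 := congrArg (Polynomial.eval 0) hprod
      rw [Polynomial.eval_prod, Finset.prod_eq_zero hi (by simp [h0])] at h1
      simp at h1
    have hP : (1 - PowerSeries.C 2 * PowerSeries.X + PowerSeries.X ^ (h + 1) : PowerSeries ℂ) =
        ∏ i ∈ range (h + 1), (PowerSeries.X - PowerSeries.C (r i)) := by
      have h1 := congrArg (Polynomial.coeToPowerSeries.ringHom (R := ℂ)) hprod
      simpa only [map_prod, map_sub, map_add, map_mul, map_pow, map_one,
        Polynomial.coeToPowerSeries.ringHom_apply, Polynomial.coe_C, Polynomial.coe_X] using h1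
    have hne : (range (h + 1)).Nonempty := ⟨0, by simp⟩
    have hinj' : Set.InjOn r (range (h + 1)) := fun i hi j hj => hinj i hi j hj
    have hcoeff := coeff_inv_prod_X_sub_C hinj' hne hr0
    rw [← hP] at hcoeff
    exact ⟨hr0, hinj, hP ▸ inv_prod_X_sub_C hinj' hne hr0, hcoeff,
      genFib_eq_sum hh hinj' hr0 hcoeff⟩
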